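/- For integers $n\ge k\ge 1$, let the Kneser graph $K(n,k)$ be the graph whose vertices are the $k$-element subsets of $\{1,\dots,n\}$, two vertices being adjacent if and only if they are disjoint; $K(2k+1,k)$ is called the Odd graph. For a finite nonempty graph $G=(V,E)$ and $f:V\to\mathbb{R}$, a vertex $a$ is a local maximum of $f$ on $G$ if $f(a)\ge f(b)$ for every neighbour $b$ of $a$. A deterministic algorithm $\Gamma$ for local search on $G$ has access to $f$ only through queries: it adaptively chooses a vertex $a$ and receives $f(a)$, all other computation is free, and for every $f:V\to\mathbb{R}$ it must stop and output a local maximum of $f$ on $G$. Let $T(G,f,\Gamma)$ be the number of queries that $\Gamma$ makes on $f$, and let $$D[LS(G)]=\min_{\Gamma}\,\max_{f:V\to\mathbb{R}}\,T(G,f,\Gamma)$$ be the deterministic query complexity of local search on $G$. **Theorem.** $D[LS(K(2k+1,k))]\in\Omega\!\left(\frac1k\binom{2k+1}{k}\right)$; that is, there is an absolute constant $c>0$ such that for all integers $k\ge1$, $$D[LS(K(2k+1,k))]\;\ge\; c\cdot\frac1k\binom{2k+1}{k}.$$ -/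

import Mathlib

/-- The Kneser graph `K(n, k)`: the vertices are the size-`k` subsets of an `n`-element set, and two
(distinct) vertices are adjacent iff they are disjoint. For `k ≥ 1` disjoint vertices are
automatically distinct; `s ≠ t` only removes the loop that `k = 0` would produce. -/
def kneserGraph (n k : ℕ) : SimpleGraph {s : Finset (Fin n) // s.card = k} where
  Adj s t := s ≠ t ∧ Disjoint s.1 t.1
  symm := ⟨fun _ _ h => ⟨h.1.symm, h.2.symm⟩⟩
  loopless := ⟨fun _ h => h.1 rfl⟩

/-- The Odd graph `K(2k + 1, k)`. -/
abbrev oddGraph (k : ℕ) : SimpleGraph {s : Finset (Fin (2 * k + 1)) // s.card = k} :=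
  kneserGraph (2 * k + 1) k

namespace LocalSearch

/-- A deterministic (adaptive) query algorithm with black-box access to some `f : V → ℝ`: it either
stops and returns a vertex, or queries a vertex `v` and continues in an arbitrary way that depends
on the answer `f v`. The type is inductive, so the algorithm stops on every oracle; all
computation other than queries is free. -/
inductive QueryAlgorithm (V : Type*) : Type _
  | output (a : V) : QueryAlgorithm V
  | query (v : V) (next : ℝ → QueryAlgorithm V) : QueryAlgorithm V

namespace QueryAlgorithm

variable {V : Type*}

/-- The vertex returned when the algorithm is run on the oracle `f`. -/
def result (f : V → ℝ) : QueryAlgorithm V → V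
  | output a => a
  | query v next => result f (next (f v))

/-- The number of queries made when the algorithm is run on the oracle `f`. -/
def numQueries (f : V → ℝ) : QueryAlgorithm V → ℕ
  | output _ => 0
  | query v next => numQueries f (next (f v)) + 1

end QueryAlgorithm

/-- `a` is a local maximum of `f` on `G`: `f a ≥ f b` for every neighbour `b` of `a`. -/
def IsLocalMaximum {V : Type*} (G : SimpleGraph V) (f : V → ℝ) (a : V) : Prop :=
  ∀ b, G.Adj a b → f b ≤ f a

/-- The algorithm solves local search on `G`: on every oracle it returns a local maximum. -/
def QueryAlgorithm.Solves {V : Type*} (Γ : QueryAlgorithm V) (G : SimpleGraph V) : Prop :=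
  ∀ f : V → ℝ, IsLocalMaximum G f (Γ.result f)

/-- The deterministic query complexity `D[LS(G)] = min_Γ max_f T(G, f, Γ)` of local search on `G`:
the least `T` such that some algorithm solves local search on `G` with at most `T` queries on
every oracle. By `deterministicQueryComplexity_isLeast` the minimum is attained for every finite
nonempty graph, so no default value of `sInf` is involved there. -/
noncomputable def deterministicQueryComplexity {V : Type*} (G : SimpleGraph V) : ℕ :=
  sInf {T : ℕ | ∃ Γ : QueryAlgorithm V, Γ.Solves G ∧ ∀ f : V → ℝ, Γ.numQueries f ≤ T}

/-- Query the vertices of a list in order, then output a vertex chosen from the recorded answers. -/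
noncomputable def QueryAlgorithm.queryList {V : Type*} [DecidableEq V] (choose : (V → ℝ) → V) :
    List V → (V → ℝ) → QueryAlgorithm V
  | [], g => .output (choose g)
  | v :: l, g => .query v fun x => queryList choose l (Function.update g v x)

theorem QueryAlgorithm.queryList_spec {V : Type*} [DecidableEq V] (choose : (V → ℝ) → V)
    (f : V → ℝ) (l : List V) (g : V → ℝ) (hg : ∀ v, v ∉ l → g v = f v) :
    (queryList choose l g).result f = choose f ∧
      (queryList choose l g).numQueries f = l.length := by
  induction l generalizing g with
  | nil =>
    have : g = f := funext fun v => hg v (by simp)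
    simp [queryList, result, numQueries, this]
  | cons v l ih =>
    have h := ih (Function.update g v (f v)) (by
      intro w hw
      by_cases hwv : w = v
      · subst hwv; simp
      · rw [Function.update_of_ne hwv]
        exact hg w (by simp [hwv, hw]))
    simp [queryList, result, numQueries, h.1, h.2]

theorem deterministicQueryComplexity_isLeast {V : Type*} [Finite V] [Nonempty V]
    (G : SimpleGraph V) :
    IsLeast {T : ℕ | ∃ Γ : QueryAlgorithm V, Γ.Solves G ∧ ∀ f : V → ℝ, Γ.numQueries f ≤ T}
      (deterministicQueryComplexity G) := by
  classical
  have := Fintype.ofFinite V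
  choose m hm using fun f : V → ℝ => Finite.exists_max f
  have key := fun f => QueryAlgorithm.queryList_spec m f (Finset.univ : Finset V).toList 0
    (by simp)
  refine ⟨Nat.sInf_mem ⟨_, .queryList m (Finset.univ : Finset V).toList 0, fun f b _ => ?_,
    fun f => (key f).2.le⟩, fun T hT => Nat.sInf_le hT⟩
  rw [(key f).1]
  exact hm f b

end LocalSearch

/-!
The lower bound holds because the Odd graph has no small balanced separator.

*Adversary.* Suppose that deleting any set of at most `T` vertices leaves a connected component
with more than half of the vertices. Against an algorithm, keep a set `S` of at most `T` deleted
vertices and such a component `C` of the rest. Off `C` the values of `f` are already fixed, and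
every vertex there has a neighbour which is larger or lies in `C`, where all values will be larger.
A query outside `C` is answered with the fixed value. A query `v` in `C` adds `v` to `S`; the new
large component `C'` meets `C`, hence lies in it, and the values on `C \ C'` are now fixed so as to
increase towards a point of `C'`. After `T` such queries no vertex can safely be output, because a
vertex of the nontrivial component `C` can still be given a value below that of its neighbours
(`QueryAlgorithm.exists_oracle_defeating`).

*Separators.* In a vertex-transitive graph on `N` vertices where any two vertices are joined by a
walk of length at most `d`, fix a vertex `x` and, for each `y`, a short walk from `x` to `y`, and
move it by a uniformly random automorphism. Each of its at most `d + 1` vertices becomes uniformly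
distributed, so the walk meets `S` with probability at most `(d + 1) |S| / N`. If all components of
the complement of `S` have at most `N / 2` vertices, then for at least half of the `y` the walk has
to meet `S`; hence `N ≤ 2 (d + 1) |S|` (`card_le_of_forall_component_le_half`).

The Odd graph `K(2k + 1, k)` is vertex-transitive, and two steps in it exchange one element of a
`k`-set for any other, so `d = 2k` will do.
-/

/-! ### Deleting a set of vertices -/

namespace SimpleGraph

variable {V : Type*}

/-- The graph `G` with all edges that meet `S` removed. The vertices of `S` are kept as isolated
points, so that the vertex type does not change with `S`. -/
def isolate (G : SimpleGraph V) (S : Finset V) : SimpleGraph V where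
  Adj a b := G.Adj a b ∧ a ∉ S ∧ b ∉ S
  symm := ⟨fun _ _ h => ⟨h.1.symm, h.2.2, h.2.1⟩⟩
  loopless := ⟨fun _ h => G.loopless.irrefl _ h.1⟩

theorem isolate_anti (G : SimpleGraph V) {S S' : Finset V} (h : S ⊆ S') :
    G.isolate S' ≤ G.isolate S :=
  fun _ _ hab => ⟨hab.1, fun ha => hab.2.1 (h ha), fun hb => hab.2.2 (h hb)⟩

theorem isolate_empty (G : SimpleGraph V) : G.isolate ∅ = G := by
  ext a b
  simp [isolate]

theorem Walk.reachable_isolate {G : SimpleGraph V} {S : Finset V} {x y : V} (p : G.Walk x y)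
    (hp : ∀ v ∈ p.support, v ∉ S) : (G.isolate S).Reachable x y := by
  induction p with
  | nil => exact Reachable.refl _
  | @cons u v w h p ih =>
    have huv : (G.isolate S).Adj u v := ⟨h, hp u (by simp), hp v (by simp)⟩
    exact huv.reachable.trans (ih fun z hz => hp z (by simp [hz]))

theorem Reachable.exists_adj_of_ne {G : SimpleGraph V} {u w : V} (h : G.Reachable u w)
    (hne : u ≠ w) : ∃ u', G.Adj u u' ∧ G.dist u' w < G.dist u w := by
  obtain ⟨p, hp⟩ := h.exists_walk_length_eq_dist
  cases p with
  | nil => exact absurd rfl hne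
  | @cons _ u' _ ha q =>
    refine ⟨u', ha, ?_⟩
    have := G.dist_le q
    rw [Walk.length_cons] at hp
    omega

/-- The vertices reachable from `c` after the edges meeting `S` have been removed. -/
noncomputable def component [Fintype V] (G : SimpleGraph V) (S : Finset V) (c : V) : Finset V :=
  open Classical in Finset.univ.filter fun x => (G.isolate S).Reachable c x

theorem mem_component [Fintype V] {G : SimpleGraph V} {S : Finset V} {c x : V} :
    x ∈ G.component S c ↔ (G.isolate S).Reachable c x := by
  classical simp [component]

theorem self_mem_component [Fintype V] {G : SimpleGraph V} {S : Finset V} {c : V} :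
    c ∈ G.component S c :=
  mem_component.2 (Reachable.refl _)

theorem exists_adj_mem_component [Fintype V] {G : SimpleGraph V} {S : Finset V} {c x : V}
    (hc : 2 ≤ (G.component S c).card) (hx : x ∈ G.component S c) :
    ∃ y ∈ G.component S c, (G.isolate S).Adj x y := by
  obtain ⟨z, hz, hzx⟩ := Finset.exists_mem_ne hc x
  rw [mem_component] at hx hz
  obtain ⟨y, hxy, -⟩ := (hx.symm.trans hz).exists_adj_of_ne hzx.symm
  exact ⟨y, mem_component.2 (hx.trans hxy.reachable), hxy⟩

/-- A component with more than half of the vertices absorbs every such component that remains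
after further vertices are deleted, since the two have to meet. -/
theorem component_subset_of_large [Fintype V] {G : SimpleGraph V} {S S' : Finset V} {c c' : V}
    (hS : S ⊆ S') (hc : Fintype.card V < 2 * (G.component S c).card)
    (hc' : Fintype.card V < 2 * (G.component S' c').card) :
    G.component S' c' ⊆ G.component S c := by
  classical
  have hcard := Finset.card_union_add_card_inter (G.component S c) (G.component S' c')
  have hle := Finset.card_le_univ (G.component S c ∪ G.component S' c')
  obtain ⟨z, hz⟩ : (G.component S c ∩ G.component S' c').Nonempty :=
    Finset.card_pos.1 (by omega)
  rw [Finset.mem_inter, mem_component, mem_component] at hz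
  intro x hx
  exact mem_component.2
    (hz.1.trans ((hz.2.symm.trans (mem_component.1 hx)).mono (G.isolate_anti hS)))

/-- A vertex of a nontrivial component has not been deleted. -/
theorem notMem_of_mem_component [Fintype V] {G : SimpleGraph V} {S : Finset V} {c x : V}
    (hc : 2 ≤ (G.component S c).card) (hx : x ∈ G.component S c) : x ∉ S := by
  obtain ⟨y, -, hxy⟩ := exists_adj_mem_component hc hx
  exact hxy.2.1

end SimpleGraph

/-! ### The adversary -/

namespace LocalSearch

open SimpleGraph

variable {V : Type*} [Fintype V]

/-- The adversary's strategy, by recursion on the algorithm. The values `g` off the current large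
component are fixed and bounded by `l`; `t` is the number of further vertices that may be deleted,
that is, the number of queries inside the large component that the adversary can survive. -/
theorem QueryAlgorithm.exists_oracle_defeating (G : SimpleGraph V) (T : ℕ)
    (hV : 2 ≤ Fintype.card V)
    (hT : ∀ S : Finset V, S.card ≤ T → ∃ c, Fintype.card V < 2 * (G.component S c).card)
    (Γ : QueryAlgorithm V) :
    ∀ (t : ℕ) (S : Finset V) (c : V) (g : V → ℝ) (l : ℝ), S.card + t ≤ T →
      Fintype.card V < 2 * (G.component S c).card →
      (∀ u ∉ G.component S c, g u ≤ l) →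
      (∀ u ∉ G.component S c, ∃ w, G.Adj u w ∧ (w ∈ G.component S c ∨ g u < g w)) →
      ∃ f : V → ℝ, (∀ u ∉ G.component S c, f u = g u) ∧
        (IsLocalMaximum G f (Γ.result f) → t < Γ.numQueries f) := by
  classical
  induction Γ with
  | output a =>
    intro t S c g l _ hc hl hg
    have hc2 : 2 ≤ (G.component S c).card := by omega
    -- Inside the component, `a` gets the smallest value; off it, all values are at most `l`.
    refine ⟨fun u => if u ∈ G.component S c then (if u = a then l + 1 else l + 2) else g u,
      fun u hu => if_neg hu, fun hmax => ?_⟩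
    exfalso
    change IsLocalMaximum G _ a at hmax
    by_cases ha : a ∈ G.component S c
    · obtain ⟨b, hb, hab⟩ := exists_adj_mem_component hc2 ha
      have h := hmax b hab.1
      simp only [ha, hb, if_true, hab.ne.symm, if_false] at h
      linarith
    · obtain ⟨w, haw, hw⟩ := hg a ha
      have h := hmax w haw
      have hla := hl a ha
      by_cases hwC : w ∈ G.component S c
      · simp only [ha, hwC, if_true, haw.ne.symm, if_false] at h
        linarith
      · simp only [ha, hwC, if_false] at h
        exact absurd (hw.resolve_left hwC) (not_lt.2 h)
  | query v next ih =>
    intro t S c g l hSt hc hl hg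
    by_cases hv : v ∈ G.component S c
    swap
    · obtain ⟨f, hf, hmax⟩ := ih (g v) t S c g l hSt hc hl hg
      refine ⟨f, hf, fun h => ?_⟩
      simp only [result, numQueries, hf v hv] at h ⊢
      exact (hmax h).trans (Nat.lt_succ_self _)
    cases t with
    | zero => exact ⟨g, fun _ _ => rfl, fun _ => Nat.succ_pos _⟩
    | succ t =>
      have hcard : (insert v S).card ≤ S.card + 1 := Finset.card_insert_le v S
      obtain ⟨c', hc'⟩ := hT (insert v S) (by omega)
      have hsub := component_subset_of_large (Finset.subset_insert v S) hc hc'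
      have hv' : v ∉ G.component (insert v S) c' := fun h =>
        notMem_of_mem_component (by omega) h (Finset.mem_insert_self v S)
      -- On the part of the old component that is given up, the values lie in `(l, l + 1]` and
      -- increase towards `c'`.
      set g' : V → ℝ := fun u =>
        if u ∈ G.component S c then l + 1 / (1 + ((G.isolate S).dist u c' : ℝ)) else g u with hg'
      have hlow : ∀ u ∈ G.component S c, l < g' u := fun u hu => by
        simp only [hg', hu, if_true, lt_add_iff_pos_right]
        positivity
      have hout : ∀ u ∉ G.component S c, g' u = g u := fun u hu => if_neg hu
      obtain ⟨f, hf, hmax⟩ := ih (g' v) t (insert v S) c' g' (l + 1) (by omega) hc'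
        (fun u _ => by
          by_cases hu : u ∈ G.component S c
          · simp only [hg', hu, if_true, add_le_add_iff_left]
            have : (0 : ℝ) ≤ (G.isolate S).dist u c' := Nat.cast_nonneg _
            exact div_le_one_of_le₀ (by linarith) (by positivity)
          · rw [hout u hu]
            linarith [hl u hu])
        (fun u hu' => by
          by_cases hu : u ∈ G.component S c
          · have hreach : (G.isolate S).Reachable u c' :=
              (mem_component.1 hu).symm.trans (mem_component.1 (hsub self_mem_component))
            have hne : u ≠ c' := fun h => hu' (h ▸ self_mem_component)
            obtain ⟨w, huw, hlt⟩ := hreach.exists_adj_of_ne hne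
            have hw : w ∈ G.component S c :=
              mem_component.2 ((mem_component.1 hu).trans huw.reachable)
            refine ⟨w, huw.1, Or.inr ?_⟩
            simp only [hg', hu, hw, if_true, add_lt_add_iff_left]
            have : ((G.isolate S).dist w c' : ℝ) < (G.isolate S).dist u c' := by
              exact_mod_cast hlt
            exact one_div_lt_one_div_of_lt (by positivity) (by linarith)
          · obtain ⟨w, huw, hw⟩ := hg u hu
            refine ⟨w, huw, Or.inr ?_⟩
            rw [hout u hu]
            by_cases hwC : w ∈ G.component S c
            · exact (hl u hu).trans_lt (hlow w hwC)
            · rw [hout w hwC]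
              exact hw.resolve_left hwC)
      refine ⟨f, fun u hu => (hf u fun h => hu (hsub h)).trans (hout u hu), fun h => ?_⟩
      simp only [result, numQueries, hf v hv'] at h ⊢
      exact Nat.succ_lt_succ (hmax h)

theorem lt_deterministicQueryComplexity {G : SimpleGraph V} (hG : G.Preconnected) {T : ℕ}
    (hV : 2 ≤ Fintype.card V)
    (hT : ∀ S : Finset V, S.card ≤ T → ∃ c, Fintype.card V < 2 * (G.component S c).card) :
    T < deterministicQueryComplexity G := by
  have : Nonempty V := Fintype.card_pos_iff.1 (by omega)
  obtain ⟨Γ, hΓ, hq⟩ := (deterministicQueryComplexity_isLeast G).1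
  obtain ⟨c, hc⟩ := hT ∅ (by simp)
  have huniv : ∀ u, u ∈ G.component ∅ c := fun u =>
    mem_component.2 (by rw [isolate_empty]; exact hG c u)
  obtain ⟨f, -, hf⟩ := Γ.exists_oracle_defeating G T hV hT T ∅ c 0 0 (by simp) hc
    (fun u hu => absurd (huniv u) hu) (fun u hu => absurd (huniv u) hu)
  exact (hf (hΓ f)).trans_le (hq f)

end LocalSearch

/-! ### Separators of vertex-transitive graphs -/

namespace SimpleGraph

variable {V : Type*} [Fintype V]

/-- Under a uniformly random automorphism of a vertex-transitive graph, the image of a vertex is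
uniformly distributed. -/
theorem card_mul_card_automorphisms_mem {G : SimpleGraph V} [Fintype (G ≃g G)] [DecidableEq V]
    (htrans : ∀ x y : V, ∃ φ : G ≃g G, φ x = y) (S : Finset V) (v : V) :
    Fintype.card V * (Finset.univ.filter fun φ : G ≃g G => φ v ∈ S).card =
      S.card * Fintype.card (G ≃g G) := by
  have hconst : ∀ w, (Finset.univ.filter fun φ : G ≃g G => φ v = w).card =
      (Finset.univ.filter fun φ : G ≃g G => φ v = v).card := fun w => by
    obtain ⟨ψ, hψ⟩ := htrans v w
    refine Finset.card_bij' (fun φ _ => φ.trans ψ.symm) (fun φ _ => φ.trans ψ) ?_ ?_ ?_ ?_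
    · intro φ hφ
      simp only [Finset.mem_filter, Finset.mem_univ, true_and] at hφ ⊢
      simp [hφ, ← hψ]
    · intro φ hφ
      simp only [Finset.mem_filter, Finset.mem_univ, true_and] at hφ ⊢
      simp [hφ, hψ]
    · intro φ _
      ext x
      simp
    · intro φ _
      ext x
      simp
  have hcount : ∀ R : Finset V, (Finset.univ.filter fun φ : G ≃g G => φ v ∈ R).card =
      R.card * (Finset.univ.filter fun φ : G ≃g G => φ v = v).card := fun R => by
    rw [Finset.card_eq_sum_card_fiberwise (f := fun φ : G ≃g G => φ v) (t := R)
      (fun φ hφ => by simpa using hφ), Finset.sum_const_nat]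
    intro w hw
    rw [← hconst w, Finset.filter_filter]
    congr 1
    ext φ
    simp only [Finset.mem_filter, Finset.mem_univ, true_and]
    exact ⟨fun h => h.2, fun h => ⟨h ▸ hw, h⟩⟩
  have huniv := hcount Finset.univ
  simp only [Finset.mem_univ, Finset.filter_true, Finset.card_univ] at huniv
  rw [hcount S, huniv]
  ring

/-- A set whose deletion leaves no component with more than half of the vertices is large: double
count the pairs `(φ, y)` for which `φ` moves the chosen walk from `x` to `y` onto `S`. -/
theorem card_le_of_forall_component_le_half {G : SimpleGraph V}
    (htrans : ∀ x y : V, ∃ φ : G ≃g G, φ x = y) {d : ℕ}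
    (hd : ∀ x y : V, ∃ p : G.Walk x y, p.length ≤ d) (S : Finset V)
    (hS : ∀ c, 2 * (G.component S c).card ≤ Fintype.card V) :
    Fintype.card V ≤ 2 * ((d + 1) * S.card) := by
  classical
  rcases isEmpty_or_nonempty V with hV | ⟨⟨x⟩⟩
  · simp
  have : Finite (G ≃g G) :=
    Finite.of_injective (fun φ : G ≃g G => (φ : V → V)) DFunLike.coe_injective
  have := Fintype.ofFinite (G ≃g G)
  choose p hp using hd x
  have hN : 0 < Fintype.card V := Fintype.card_pos_iff.2 ⟨x⟩
  have hA : 0 < Fintype.card (G ≃g G) := Fintype.card_pos_iff.2 ⟨RelIso.refl _⟩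
  set sep : (G ≃g G) → V → Prop := fun φ y => ¬ (G.isolate S).Reachable (φ x) (φ y) with hsep
  have hlower : ∀ φ : G ≃g G,
      Fintype.card V ≤ 2 * (Finset.univ.filter fun y => sep φ y).card := fun φ => by
    have h1 : (Finset.univ.filter fun y => ¬ sep φ y).card = (G.component S (φ x)).card := by
      refine Finset.card_bij (fun y _ => φ y) ?_ (fun _ _ _ _ h => φ.injective h) ?_
      · intro y hy
        simpa [hsep, mem_component] using hy
      · intro z hz
        refine ⟨φ.symm z, ?_, by simp⟩
        simpa [hsep, mem_component] using hz
    have h2 := Finset.card_filter_add_card_filter_not (s := (Finset.univ : Finset V))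
      (fun y => sep φ y)
    rw [Finset.card_univ] at h2
    have h3 := hS (φ x)
    omega
  have hupper : ∀ y, Fintype.card V * (Finset.univ.filter fun φ => sep φ y).card ≤
      (d + 1) * S.card * Fintype.card (G ≃g G) := fun y => by
    have hsub : (Finset.univ.filter fun φ => sep φ y) ⊆ (p y).support.toFinset.biUnion
        fun v => Finset.univ.filter fun φ : G ≃g G => φ v ∈ S := by
      intro φ hφ
      by_contra hcon
      simp only [Finset.mem_biUnion, List.mem_toFinset, Finset.mem_filter, Finset.mem_univ,
        true_and, not_exists, not_and] at hcon hφ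
      refine hφ (((p y).map φ.toHom).reachable_isolate fun z hz => ?_)
      rw [Walk.support_map, List.mem_map] at hz
      obtain ⟨v, hv, rfl⟩ := hz
      exact hcon v hv
    have hlen : (p y).support.toFinset.card ≤ d + 1 :=
      (List.toFinset_card_le _).trans (by rw [Walk.length_support]; exact Nat.succ_le_succ (hp y))
    calc Fintype.card V * (Finset.univ.filter fun φ => sep φ y).card
        ≤ Fintype.card V * ∑ v ∈ (p y).support.toFinset,
            (Finset.univ.filter fun φ : G ≃g G => φ v ∈ S).card :=
          Nat.mul_le_mul_left _ ((Finset.card_le_card hsub).trans Finset.card_biUnion_le)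
      _ = (p y).support.toFinset.card * (S.card * Fintype.card (G ≃g G)) := by
          rw [Finset.mul_sum, Finset.sum_const_nat fun v _ =>
            card_mul_card_automorphisms_mem htrans S v]
      _ ≤ (d + 1) * (S.card * Fintype.card (G ≃g G)) := Nat.mul_le_mul_right _ hlen
      _ = _ := by ring
  have hdouble : ∑ φ : G ≃g G, (Finset.univ.filter fun y => sep φ y).card =
      ∑ y : V, (Finset.univ.filter fun φ => sep φ y).card :=
    Finset.sum_card_bipartiteAbove_eq_sum_card_bipartiteBelow sep
  have h1 : Fintype.card (G ≃g G) * Fintype.card V ≤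
      2 * ∑ y : V, (Finset.univ.filter fun φ => sep φ y).card := by
    rw [← hdouble, Finset.mul_sum, ← smul_eq_mul, ← Finset.card_univ (α := G ≃g G)]
    exact Finset.card_nsmul_le_sum _ _ _ fun φ _ => hlower φ
  have h2 : Fintype.card V * ∑ y : V, (Finset.univ.filter fun φ => sep φ y).card ≤
      Fintype.card V * ((d + 1) * S.card * Fintype.card (G ≃g G)) := by
    rw [Finset.mul_sum, ← smul_eq_mul (Fintype.card V) ((d + 1) * _ * _),
      ← Finset.card_univ (α := V)]
    exact Finset.sum_le_card_nsmul _ _ _ fun y _ => hupper y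
  have h3 := Nat.le_of_mul_le_mul_left h2 hN
  refine Nat.le_of_mul_le_mul_left (c := Fintype.card (G ≃g G)) ?_ hA
  calc _ ≤ _ := h1
    _ ≤ 2 * ((d + 1) * S.card * Fintype.card (G ≃g G)) := Nat.mul_le_mul_left _ h3
    _ = _ := by ring

end SimpleGraph

/-! ### The Odd graph -/

theorem kneserGraph_exists_automorphism {n k : ℕ} (s t : {s : Finset (Fin n) // s.card = k}) :
    ∃ φ : kneserGraph n k ≃g kneserGraph n k, φ s = t := by
  obtain ⟨s, hs⟩ := s
  obtain ⟨t, ht⟩ := t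
  let e : {x // x ∈ s} ≃ {x // x ∈ t} := Finset.equivOfCardEq (hs.trans ht.symm)
  let σ : Equiv.Perm (Fin n) := e.extendSubtype
  refine ⟨⟨(Equiv.finsetCongr σ).subtypeEquiv fun a => by simp, ?_⟩, ?_⟩
  · intro a b
    simp [kneserGraph, Subtype.ext_iff]
  · apply Subtype.ext
    change s.map σ.toEmbedding = t
    refine Finset.eq_of_subset_of_card_le (fun x hx => ?_) (by simp [hs, ht])
    obtain ⟨y, hy, rfl⟩ := Finset.mem_map.1 hx
    exact e.extendSubtype_mem y hy

/-- Two steps in the Odd graph exchange one element of a set, by way of the complement of the union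
of the two sets. -/
theorem oddGraph_exists_walk {k : ℕ} (hk : 1 ≤ k) (m : ℕ) :
    ∀ s t : {s : Finset (Fin (2 * k + 1)) // s.card = k}, (s.1 \ t.1).card = m →
      ∃ p : (oddGraph k).Walk s t, p.length ≤ 2 * m := by
  induction m with
  | zero =>
    intro s t h
    have hsub : s.1 ⊆ t.1 := Finset.sdiff_eq_empty_iff_subset.1 (Finset.card_eq_zero.1 h)
    obtain rfl : s = t :=
      Subtype.ext (Finset.eq_of_subset_of_card_le hsub (by rw [s.2, t.2]))
    exact ⟨.nil, by simp⟩
  | succ m ih =>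
    intro s t h
    obtain ⟨a, ha⟩ : (s.1 \ t.1).Nonempty := Finset.card_pos.1 (by omega)
    obtain ⟨b, hb⟩ : (t.1 \ s.1).Nonempty := Finset.card_pos.1 (by
      rw [← Finset.card_sdiff_comm (s.2.trans t.2.symm)]; omega)
    rw [Finset.mem_sdiff] at ha hb
    let d : {s : Finset (Fin (2 * k + 1)) // s.card = k} := ⟨(insert b s.1)ᶜ, by
      rw [Finset.card_compl, Finset.card_insert_of_notMem hb.2, s.2, Fintype.card_fin]; omega⟩
    let s' : {s : Finset (Fin (2 * k + 1)) // s.card = k} := ⟨insert b (s.1.erase a), by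
      rw [Finset.card_insert_of_notMem (fun h => hb.2 (Finset.mem_of_mem_erase h)),
        Finset.card_erase_of_mem ha.1, s.2]; omega⟩
    have hsd : (oddGraph k).Adj s d := by
      refine ⟨fun h => ?_, ?_⟩
      · have : a ∈ d.1 := h ▸ ha.1
        simp [d, ha.1] at this
      · exact disjoint_compl_right.mono_left (Finset.subset_insert b s.1)
    have hds' : (oddGraph k).Adj d s' := by
      refine ⟨fun h => ?_, ?_⟩
      · have : b ∈ d.1 := h ▸ Finset.mem_insert_self b _
        simp [d] at this
      · exact disjoint_compl_left.mono_right
          (Finset.insert_subset_insert b (Finset.erase_subset a s.1))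
    have hdiff : s'.1 \ t.1 = (s.1 \ t.1).erase a := by
      ext x
      simp only [s', Finset.mem_sdiff, Finset.mem_insert, Finset.mem_erase]
      constructor
      · rintro ⟨rfl | hx, hxt⟩
        · exact absurd hb.1 hxt
        · exact ⟨hx.1, hx.2, hxt⟩
      · exact fun hx => ⟨Or.inr ⟨hx.1, hx.2.1⟩, hx.2.2⟩
    obtain ⟨p, hp⟩ := ih s' t (by
      rw [hdiff, Finset.card_erase_of_mem (Finset.mem_sdiff.2 ha), h]; rfl)
    refine ⟨.cons hsd (.cons hds' p), ?_⟩
    rw [SimpleGraph.Walk.length_cons, SimpleGraph.Walk.length_cons]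
    omega

theorem choose_le_mul_deterministicQueryComplexity_oddGraph {k : ℕ} (hk : 1 ≤ k) :
    (2 * k + 1).choose k ≤
      2 * ((2 * k + 1) * LocalSearch.deterministicQueryComplexity (oddGraph k)) := by
  have hcard : Fintype.card {s : Finset (Fin (2 * k + 1)) // s.card = k} =
      (2 * k + 1).choose k := by
    rw [Fintype.card_finset_len, Fintype.card_fin]
  have htwo : 2 ≤ (2 * k + 1).choose k := by
    have h := Nat.choose_le_choose k (show k + 1 ≤ 2 * k + 1 by omega)
    rw [Nat.choose_succ_self_right] at h
    omega
  have hwalk : ∀ s t, ∃ p : (oddGraph k).Walk s t, p.length ≤ 2 * k := fun s t => by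
    obtain ⟨p, hp⟩ := oddGraph_exists_walk hk _ s t rfl
    have : (s.1 \ t.1).card ≤ k := (Finset.card_le_card Finset.sdiff_subset).trans s.2.le
    exact ⟨p, by omega⟩
  by_contra! hlt
  refine lt_irrefl _ (LocalSearch.lt_deterministicQueryComplexity (G := oddGraph k)
    (fun s t => (hwalk s t).choose.reachable) (hcard ▸ htwo) fun S hS => ?_)
  by_contra! hsmall
  have h := SimpleGraph.card_le_of_forall_component_le_half
    kneserGraph_exists_automorphism hwalk S hsmall
  rw [hcard] at h
  have := Nat.mul_le_mul_left (2 * k + 1) hS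
  omega

theorem mainTheorem3 :
    ∃ c : ℝ, 0 < c ∧ ∀ k : ℕ, 1 ≤ k →
      c * ((1 / (k : ℝ)) * ((2 * k + 1).choose k : ℝ)) ≤
        (LocalSearch.deterministicQueryComplexity (oddGraph k) : ℝ) := by
  -- `1 / 6` comes from `2 (2k + 1) ≤ 6k`.
  refine ⟨1 / 6, by norm_num, fun k hk => ?_⟩
  have hk' : (1 : ℝ) ≤ k := by exact_mod_cast hk
  have h : ((2 * k + 1).choose k : ℝ) ≤
      2 * ((2 * k + 1) * (LocalSearch.deterministicQueryComplexity (oddGraph k) : ℝ)) := by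
    exact_mod_cast choose_le_mul_deterministicQueryComplexity_oddGraph hk
  have hD : (0 : ℝ) ≤ LocalSearch.deterministicQueryComplexity (oddGraph k) := Nat.cast_nonneg _
  rw [one_div_mul_eq_div, one_div_mul_eq_div, div_div, div_le_iff₀ (by positivity)]
  nlinarith
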